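/- Regard the set $\mathbb{Z}^{2\times 2}$ of $2\times 2$ integer matrices as a semigroup under matrix multiplication. A subgroup of $\mathbb{Z}^{2\times 2}$ is a multiplicatively closed subset that is a group under matrix multiplication (its identity element need not be the identity matrix; the subgroups whose identity element is the identity matrix are exactly the subgroups of $GL(2,\mathbb{Z})$). The subgroup membership problem for finitely generated subgroups of $\mathbb{Z}^{2\times 2}$ is decidable, uniformly in the generators: there is an algorithm which, given a list of matrices $h_1,\dots,h_n\in\mathbb{Z}^{2\times 2}$ ($n\ge 1$) that generate a subgroup $H$ of $\mathbb{Z}^{2\times 2}$ (that is, $H$ is the smallest subgroup of $\mathbb{Z}^{2\times 2}$ containing $h_1,\dots,h_n$) and a matrix $Y\in\mathbb{Z}^{2\times 2}$, decides whether $Y\in H$. -/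

import Mathlib

/-- Integer matrices are encoded entrywise, through the standard encodings of `ℤ` and of tuples. -/
instance matrixPrimcodable (m n : ℕ) : Primcodable (Matrix (Fin m) (Fin n) ℤ) :=
  inferInstanceAs (Primcodable (Fin m → Fin n → ℤ))

/-- A multiplicatively closed subset `H` of a semigroup is a *subgroup* of that semigroup if the
multiplication makes `H` a group. The identity element of `H` is not required to be an identity
element of the whole semigroup. -/
def IsSubgroupOfSemigroup {S : Type*} [Semigroup S] (H : Subsemigroup S) : Prop :=
  ∃ e ∈ H, ∀ x ∈ H, e * x = x ∧ x * e = x ∧ ∃ y ∈ H, x * y = e ∧ y * x = e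

/-- `H` is the subgroup of the semigroup `S` generated by the members of the list `L`: the smallest
subgroup of `S` that contains all of them. -/
def IsSubgroupGeneratedBy {S : Type*} [Semigroup S] (L : List S) (H : Subsemigroup S) : Prop :=
  IsLeast {K : Subsemigroup S | IsSubgroupOfSemigroup K ∧ ∀ h ∈ L, h ∈ K} H

/-!
Let `H` be a subgroup of the semigroup of integer matrices of size two, with identity `e`. The
idempotent `e` is `1` or singular.

If `e` is singular, then so is every `x ∈ H`, and the Cayley-Hamilton theorem gives
`x * x = tr x • x`. As `x` has an inverse in `H`, its trace is `±1` unless `e = 0`, so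
`H ⊆ {e, -e}`, and `H` can be read off from the generators
(`IsSubgroupGeneratedBy.mem_iff_of_not_isUnit`).

If `e = 1`, then `H` is the subgroup of `GL(2, ℤ)` generated by the given matrices
(`IsSubgroupGeneratedBy.mem_iff_of_isUnit`), and membership of `Y` is decided by two searches that
run in parallel. The first one looks for an expression of `Y` as a product of generators and their
inverses. The second one looks for a finite certificate that `Y ∉ H`, and its success rests on
subgroup separability. Sanov's matrices `[1, 2; 0, 1]` and `[1, 0; 2, 1]` generate a subgroup `F` of
`GL(2, ℤ)` that is free, by ping-pong (`GLTwoInt.sanovHom_injective`), and of finite index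
(`GLTwoInt.finiteIndex_range_sanovHom`). Let `T` be a finite set of representatives of the cosets
`F t`. Any choice of two permutations of a set `X` makes `X` an `F`-set, and any family of points
`s t` of `X` then extends to an `F`-equivariant map `GL(2, ℤ) → X`. The elements under whose right
multiplication this map is invariant form a subgroup, and only the products `T t * h` have to be
inspected to see that it contains the generators of `H`, or that it does not contain `Y`
(`notMem_closure_of_equivariant`).

The coset space `GL(2, ℤ) ⧸ H` with the points `t • H` is an `F`-set of this kind that separates
every `Y ∉ H` from `H`. Only finitely many of its points matter, and on finitely many points any
permutation agrees with a product of transpositions (`exists_swapProd_eq_on`). Hence `X = ℕ` and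
permutations given by finite lists of transpositions suffice (`exists_swapProd_of_notMem_closure`).
This is Marshall Hall's argument for free groups, carried over to a finite extension. As the check
of a proposed certificate is primitive recursive, the search for one is computable
(`PrimrecRel.exists_computable_choice`).
-/

/-! ### Computable choice -/

/-- A primitive recursive relation that is total on the left has a computable choice function. -/
theorem PrimrecRel.exists_computable_choice {α β : Type*} [Primcodable α] [Primcodable β]
    {R : α → β → Prop} (hR : PrimrecRel R) (h : ∀ a, ∃ b, R a b) :
    ∃ f : α → β, Computable f ∧ ∀ a, R a (f a) := by
  classical
  let g : α → ℕ → Option β := fun a n =>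
    (Encodable.decode (α := β) n).bind fun b => Option.guard (fun b => decide (R a b)) b
  have hg : Computable₂ g := by
    refine Primrec₂.to_comp ?_
    refine Primrec.option_bind (Primrec.decode.comp Primrec.snd) ?_
    exact Primrec.option_guard (p := fun (x : (α × ℕ) × β) b => R x.1.1 b)
      (hR.comp₂ (Primrec.fst.comp (Primrec.fst.comp Primrec.fst)).to₂ Primrec.snd.to₂) Primrec.snd
  have hmem : ∀ a n b, b ∈ g a n → R a b := by
    intro a n b hb
    obtain ⟨c, -, hc⟩ := Option.mem_bind_iff.1 hb
    rw [Option.mem_def, Option.guard_eq_some_iff] at hc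
    obtain ⟨rfl, hc⟩ := hc
    simpa using hc
  have hdom : ∀ a, (Nat.rfindOpt (g a)).Dom := by
    intro a
    obtain ⟨b, hb⟩ := h a
    refine Nat.rfindOpt_dom.2 ⟨Encodable.encode b, b, ?_⟩
    simp [g, hb]
  refine ⟨fun a => (Nat.rfindOpt (g a)).get (hdom a),
    (Partrec.rfindOpt hg).of_eq_tot fun a => Part.get_mem _, fun a => ?_⟩
  obtain ⟨n, hn⟩ := Nat.rfindOpt_spec (Part.get_mem (hdom a))
  exact hmem a n _ hn

/-! ### Primitive recursive arithmetic of integers and matrices -/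

namespace Primrec

-- The standard encoding of `ℤ` sends `n` to `2 * n` and `Int.negSucc n` to `2 * n + 1`.
theorem int_ofNat : Primrec (fun n : ℕ => (n : ℤ)) :=
  Primrec.encode_iff.1 (nat_double.of_eq fun _ => rfl)

theorem int_negSucc : Primrec Int.negSucc :=
  Primrec.encode_iff.1 (nat_double_succ.of_eq fun _ => rfl)

theorem int_toNat : Primrec Int.toNat := by
  have h : Primrec fun z : ℤ => if Encodable.encode z % 2 = 0 then Encodable.encode z / 2 else 0 :=
    Primrec.ite (Primrec.eq.comp (nat_mod.comp Primrec.encode (const 2)) (const 0))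
      (nat_div.comp Primrec.encode (const 2)) (const 0)
  refine h.of_eq fun z => ?_
  cases z with
  | ofNat n => change (if 2 * n % 2 = 0 then 2 * n / 2 else 0) = n; grind
  | negSucc n => change (if (2 * n + 1) % 2 = 0 then (2 * n + 1) / 2 else 0) = 0; grind

theorem int_neg_toNat : Primrec fun z : ℤ => (-z).toNat := by
  have h : Primrec fun z : ℤ =>
      if Encodable.encode z % 2 = 0 then 0 else Encodable.encode z / 2 + 1 :=
    Primrec.ite (Primrec.eq.comp (nat_mod.comp Primrec.encode (const 2)) (const 0))
      (const 0) (Primrec.succ.comp (nat_div.comp Primrec.encode (const 2)))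
  refine h.of_eq fun z => ?_
  cases z with
  | ofNat n =>
    change (if 2 * n % 2 = 0 then 0 else 2 * n / 2 + 1) = (-(n : ℤ)).toNat
    grind
  | negSucc n =>
    change (if (2 * n + 1) % 2 = 0 then 0 else (2 * n + 1) / 2 + 1) = n + 1
    grind

/-- Integers are handled as differences of natural numbers. -/
theorem int_natCast_sub : Primrec₂ fun m n : ℕ => (m : ℤ) - n := by
  have h : Primrec₂ fun m n : ℕ => if n ≤ m then ((m - n : ℕ) : ℤ) else Int.negSucc (n - m - 1) :=
    Primrec.ite (nat_le.comp snd fst) (int_ofNat.comp (nat_sub.comp fst snd))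
      (int_negSucc.comp (nat_sub.comp (nat_sub.comp snd fst) (const 1)))
  refine h.of_eq fun m n => ?_
  split_ifs with hmn <;> omega

theorem int_add : Primrec₂ ((· + ·) : ℤ → ℤ → ℤ) := by
  have h : Primrec₂ fun z w : ℤ =>
      ((z.toNat + w.toNat : ℕ) : ℤ) - (((-z).toNat + (-w).toNat : ℕ) : ℤ) :=
    int_natCast_sub.comp (nat_add.comp (int_toNat.comp fst) (int_toNat.comp snd))
      (nat_add.comp (int_neg_toNat.comp fst) (int_neg_toNat.comp snd))
  refine h.of_eq fun z w => ?_
  omega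

theorem int_mul : Primrec₂ ((· * ·) : ℤ → ℤ → ℤ) := by
  have h : Primrec₂ fun z w : ℤ =>
      ((z.toNat * w.toNat + (-z).toNat * (-w).toNat : ℕ) : ℤ) -
        ((z.toNat * (-w).toNat + (-z).toNat * w.toNat : ℕ) : ℤ) :=
    int_natCast_sub.comp
      (nat_add.comp (nat_mul.comp (int_toNat.comp fst) (int_toNat.comp snd))
        (nat_mul.comp (int_neg_toNat.comp fst) (int_neg_toNat.comp snd)))
      (nat_add.comp (nat_mul.comp (int_toNat.comp fst) (int_neg_toNat.comp snd))
        (nat_mul.comp (int_neg_toNat.comp fst) (int_toNat.comp snd)))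
  refine h.of_eq fun z w => ?_
  have hz : z = (z.toNat : ℤ) - (-z).toNat := by omega
  have hw : w = (w.toNat : ℤ) - (-w).toNat := by omega
  simp only [Nat.cast_add, Nat.cast_mul]
  conv_rhs => rw [hz, hw]
  ring

theorem matrix_apply {m n : ℕ} (i : Fin m) (j : Fin n) :
    Primrec fun A : Matrix (Fin m) (Fin n) ℤ => A i j :=
  (fin_app.comp (fin_app.comp (Primrec.id (α := Fin m → Fin n → ℤ)) (const i)) (const j) :)

theorem matrix_mk {α : Type*} [Primcodable α] {m n : ℕ} {f : α → Matrix (Fin m) (Fin n) ℤ}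
    (hf : ∀ i j, Primrec fun a => f a i j) : Primrec f := by
  have h (i : Fin m) : Primrec (fun a => (f a i : Fin n → ℤ)) :=
    fin_curry.2 (Primrec₂.swap (fin_curry₁.2 (hf i) : Primrec₂ fun (j : Fin n) a => f a i j))
  exact (fin_curry.2 (Primrec₂.swap (fin_curry₁.2 h :
    Primrec₂ fun (i : Fin m) a => (f a i : Fin n → ℤ))) :
      Primrec (fun a => (f a : Fin m → Fin n → ℤ)))

theorem matrix_mul : Primrec₂ fun A B : Matrix (Fin 2) (Fin 2) ℤ => A * B := by
  refine matrix_mk fun i j => ?_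
  have h (k : Fin 2) : Primrec fun p : Matrix (Fin 2) (Fin 2) ℤ × Matrix (Fin 2) (Fin 2) ℤ =>
      p.1 i k * p.2 k j :=
    int_mul.comp ((matrix_apply i k).comp fst) ((matrix_apply k j).comp snd)
  refine (int_add.comp (h 0) (h 1)).of_eq fun p => ?_
  simp [Matrix.mul_apply, Fin.sum_univ_two]

theorem matrix_list_prod : Primrec fun l : List (Matrix (Fin 2) (Fin 2) ℤ) => l.prod :=
  (list_foldr Primrec.id (const 1)
    (matrix_mul.comp (fst.comp snd) (snd.comp snd)).to₂).of_eq fun l => by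
      simp [List.prod]

end Primrec

/-! ### Separability of finitely generated subgroups -/

/-- The finitely supported permutation of `ℕ` that a list of pairs describes: the product of the
transpositions that exchange the two members of each pair. -/
def swapProd (l : List (ℕ × ℕ)) : Equiv.Perm ℕ :=
  (l.map fun p => Equiv.swap p.1 p.2).prod

/-- On any finite set, a permutation agrees with a product of transpositions. -/
theorem exists_swapProd_eq_on {X : Type*} {j : X → ℕ} (hj : Function.Injective j)
    (p : Equiv.Perm X) {V : Set X} (hV : V.Finite) :
    ∃ l, ∀ v ∈ V, swapProd l (j v) = j (p v) := by
  induction V, hV using Set.Finite.induction_on with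
  | empty => exact ⟨[], by simp⟩
  | @insert v V hv _ ih =>
    obtain ⟨l, hl⟩ := ih
    refine ⟨(swapProd l (j v), j (p v)) :: l, ?_⟩
    have hmul (i : ℕ) : swapProd ((swapProd l (j v), j (p v)) :: l) i =
        Equiv.swap (swapProd l (j v)) (j (p v)) (swapProd l i) := by simp [swapProd]
    rintro u (rfl | hu)
    · rw [hmul, Equiv.swap_apply_left]
    · have huv : u ≠ v := fun h => hv (h ▸ hu)
      rw [hmul, Equiv.swap_apply_of_ne_of_ne, hl u hu]
      · exact fun h => huv (hj ((swapProd l).injective h))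
      · rw [hl u hu]
        exact fun h => huv (p.injective (hj h))

/-- The effect of an element of a free group on a point depends on the action of the generators on
finitely many points only. -/
theorem FreeGroup.exists_finite_lift_apply_eq {α X : Type*} {j : X → ℕ} (p : α → Equiv.Perm X)
    (f : FreeGroup α) (v : X) :
    ∃ V : Set X, V.Finite ∧ ∀ q : α → Equiv.Perm ℕ, (∀ x, ∀ u ∈ V, q x (j u) = j (p x u)) →
      FreeGroup.lift q f (j v) = j (FreeGroup.lift p f v) := by
  induction f using FreeGroup.induction_on generalizing v with
  | C1 => exact ⟨∅, Set.finite_empty, by simp⟩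
  | of x => exact ⟨{v}, Set.finite_singleton v, fun q hq => by simpa using hq x v⟩
  | inv_of x _ =>
    refine ⟨{(p x)⁻¹ v}, Set.finite_singleton _, fun q hq => ?_⟩
    have := hq x _ (Set.mem_singleton _)
    change FreeGroup.lift q (FreeGroup.of x)⁻¹ (j v) = j (FreeGroup.lift p (FreeGroup.of x)⁻¹ v)
    rw [_root_.map_inv, _root_.map_inv, FreeGroup.lift_apply_of, FreeGroup.lift_apply_of,
      Equiv.Perm.inv_eq_iff_eq, this]
    simp
  | mul f g hf hg =>
    obtain ⟨V, hV, h⟩ := hg v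
    obtain ⟨W, hW, h'⟩ := hf (FreeGroup.lift p g v)
    refine ⟨V ∪ W, hV.union hW, fun q hq => ?_⟩
    simp only [_root_.map_mul, Equiv.Perm.mul_apply]
    rw [h q fun x u hu => hq x u (.inl hu), h' q fun x u hu => hq x u (.inr hu)]

section Separation

variable {G α ι : Type*} [Group G] {φ : FreeGroup α →* G} {T : ι → G} {L : Set G} {Y : G}

/-- Let `G` be covered by the cosets `φ(F) T t` of the image of a free group `F`, and let `F` act on
a set `X`. A family `s : ι → X` defines an `F`-equivariant map `G → X` by `φ f * T t ↦ f • s t`. If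
right multiplication by the members of `L` leaves this map unchanged and right multiplication by `Y`
does not, then `Y` is not in the subgroup generated by `L`. -/
theorem notMem_closure_of_equivariant {X : Type*}
    (hT : ∀ g, ∃ f t, g = φ f * T t)
    (hT' : ∀ f t f' t', φ f * T t = φ f' * T t' → f = f' ∧ t = t')
    (ρ : FreeGroup α →* Equiv.Perm X) (s : ι → X)
    (hL : ∀ h ∈ L, ∀ t, ∃ f t', T t * h = φ f * T t' ∧ ρ f (s t') = s t)
    (hY : ∃ t f t', T t * Y = φ f * T t' ∧ ρ f (s t') ≠ s t) :
    Y ∉ Subgroup.closure L := by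
  choose F τ hF using hT
  let σ : G → X := fun g => ρ (F g) (s (τ g))
  have hσ (f t) : σ (φ f * T t) = ρ f (s t) := by
    obtain ⟨h₁, h₂⟩ := hT' _ _ _ _ (hF (φ f * T t))
    simp only [σ, ← h₁, ← h₂]
  have hσ₁ (t) : σ (T t) = s t := by simpa using hσ 1 t
  have hσ' (f g) : σ (φ f * g) = ρ f (σ g) := by
    conv_lhs => rw [hF g, ← mul_assoc, ← map_mul, hσ]
    simp [σ]
  intro hmem
  have key : ∀ g, σ (g * Y) = σ g := by
    clear hY
    induction hmem using Subgroup.closure_induction with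
    | mem h hh =>
      intro g
      obtain ⟨f, t', h₁, h₂⟩ := hL h hh (τ g)
      conv_lhs => rw [hF g, mul_assoc, hσ', h₁, hσ, h₂]
    | one => simp
    | mul x y _ _ hx hy => intro g; rw [← mul_assoc, hy, hx]
    | inv x _ hx => intro g; rw [← hx (g * x⁻¹), inv_mul_cancel_right]
  obtain ⟨t, f, t', h₁, h₂⟩ := hY
  apply h₂
  rw [← hσ, ← h₁, key, hσ₁]

/-- Finitely generated subgroups of a group with a free subgroup of finite index are separable: the
criterion `notMem_closure_of_equivariant` is always met by an action on `ℕ` in which each generator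
of the free group is a product of transpositions.

The free group acts on `G ⧸ closure L`, and `s t = (T t) • 1` satisfies the criterion there. Only
finitely many points of this set are involved, and on these points the generators agree with
finitely supported permutations. -/
theorem exists_swapProd_of_notMem_closure [Countable G] [Finite ι]
    (hT : ∀ g, ∃ f t, g = φ f * T t) (hL : L.Finite) (hY : Y ∉ Subgroup.closure L) :
    ∃ (p : α → List (ℕ × ℕ)) (s : ι → ℕ),
      (∀ h ∈ L, ∀ t, ∃ f t', T t * h = φ f * T t' ∧
        FreeGroup.lift (fun x => swapProd (p x)) f (s t') = s t) ∧
      ∃ t f t', T t * Y = φ f * T t' ∧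
        FreeGroup.lift (fun x => swapProd (p x)) f (s t') ≠ s t := by
  let X := G ⧸ Subgroup.closure L
  have : Countable X := QuotientGroup.mk_surjective.countable
  obtain ⟨j, hj⟩ := Countable.exists_injective_nat X
  let ρ : α → Equiv.Perm X := fun x => MulAction.toPermHom G X (φ (FreeGroup.of x))
  have hρ (f : FreeGroup α) (v : X) : FreeGroup.lift ρ f v = φ f • v := by
    have : FreeGroup.lift ρ = (MulAction.toPermHom G X).comp φ :=
      FreeGroup.ext_hom _ _ (by simp [ρ])
    rw [this]; rfl
  let s : ι → X := fun t => ((T t : G) : X)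
  choose F τ hF using hT
  -- `P g t` is the set of points met on the way from `s (τ (T t * g))` along `F (T t * g)`
  choose P hP hP' using fun (g : G) (t : ι) =>
    FreeGroup.exists_finite_lift_apply_eq (j := j) ρ (F (T t * g)) (s (τ (T t * g)))
  let V : Set X := ⋃ g ∈ insert Y L, ⋃ t, P g t
  have hV : V.Finite :=
    (hL.insert Y).biUnion fun g _ => Set.finite_iUnion fun t => hP g t
  choose p hp using fun x => exists_swapProd_eq_on hj (ρ x) hV
  have key (g) (hg : g ∈ insert Y L) (t) :
      FreeGroup.lift (fun x => swapProd (p x)) (F (T t * g)) (j (s (τ (T t * g)))) =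
        j ((T t * g : G) : X) := by
    rw [hP' g t _ fun x u hu => hp x u (Set.mem_biUnion hg (Set.mem_iUnion_of_mem t hu)), hρ]
    congr 1
    change ((φ (F (T t * g)) * T (τ (T t * g)) : G) : X) = _
    rw [← hF]
  obtain ⟨-, t₀, -⟩ : ∃ f t, (1 : G) = φ f * T t := ⟨_, _, hF 1⟩
  refine ⟨p, fun t => j (s t), fun h hh t => ⟨_, _, hF _, ?_⟩, t₀, _, _, hF (T t₀ * Y), ?_⟩
  · rw [key h (.inr hh) t]
    congr 1
    simpa [s] using QuotientGroup.mk_mul_of_mem (T t) (Subgroup.subset_closure hh)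
  · rw [key Y (.inl rfl) t₀]
    intro h
    have := QuotientGroup.eq.1 (hj h)
    apply hY
    simpa using inv_mem this

end Separation

/-! ### Sanov's free subgroup of `GL(2, ℤ)` -/

namespace GLTwoInt

/-- The upper triangular member of the pair of matrices that generates Sanov's free group. -/
def sanovA : (Matrix (Fin 2) (Fin 2) ℤ)ˣ :=
  ⟨!![1, 2; 0, 1], !![1, -2; 0, 1], by decide, by decide⟩

/-- The lower triangular member of the pair of matrices that generates Sanov's free group. -/
def sanovB : (Matrix (Fin 2) (Fin 2) ℤ)ˣ :=
  ⟨!![1, 0; 2, 1], !![1, 0; -2, 1], by decide, by decide⟩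

/-- The homomorphism from the free group of rank two onto Sanov's subgroup of `GL(2, ℤ)`. -/
def sanovHom : FreeGroup (Fin 2) →* (Matrix (Fin 2) (Fin 2) ℤ)ˣ :=
  FreeGroup.lift ![sanovA, sanovB]

theorem sanovA_mul {M : (Matrix (Fin 2) (Fin 2) ℤ)ˣ} {a b c d : ℤ}
    (hM : M.1 = !![a, b; c, d]) : (sanovA * M).1 = !![a + 2 * c, b + 2 * d; c, d] := by
  rw [Units.val_mul, hM]
  ext i j; fin_cases i <;> fin_cases j <;> simp [sanovA, Matrix.mul_apply, Fin.sum_univ_two]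

theorem sanovA_inv_mul {M : (Matrix (Fin 2) (Fin 2) ℤ)ˣ} {a b c d : ℤ}
    (hM : M.1 = !![a, b; c, d]) : (sanovA⁻¹ * M).1 = !![a - 2 * c, b - 2 * d; c, d] := by
  rw [Units.val_mul, hM]
  ext i j; fin_cases i <;> fin_cases j <;>
    simp [sanovA, Matrix.mul_apply, Fin.sum_univ_two] <;> ring

theorem sanovB_mul {M : (Matrix (Fin 2) (Fin 2) ℤ)ˣ} {a b c d : ℤ}
    (hM : M.1 = !![a, b; c, d]) : (sanovB * M).1 = !![a, b; c + 2 * a, d + 2 * b] := by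
  rw [Units.val_mul, hM]
  ext i j; fin_cases i <;> fin_cases j <;>
    simp [sanovB, Matrix.mul_apply, Fin.sum_univ_two] <;> ring

theorem sanovB_inv_mul {M : (Matrix (Fin 2) (Fin 2) ℤ)ˣ} {a b c d : ℤ}
    (hM : M.1 = !![a, b; c, d]) : (sanovB⁻¹ * M).1 = !![a, b; c - 2 * a, d - 2 * b] := by
  rw [Units.val_mul, hM]
  ext i j; fin_cases i <;> fin_cases j <;>
    simp [sanovB, Matrix.mul_apply, Fin.sum_univ_two] <;> ring

theorem sanovA_zpow (k : ℤ) : (sanovA ^ k).1 = !![1, 2 * k; 0, 1] := by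
  induction k using Int.induction_on with
  | zero => simp [Matrix.one_fin_two]
  | succ k ih => rw [add_comm, zpow_one_add, sanovA_mul ih]; simp; ring
  | pred k ih => rw [sub_eq_neg_add, zpow_add, zpow_neg_one, sanovA_inv_mul ih]; simp; ring

theorem col_ne_zero (M : (Matrix (Fin 2) (Fin 2) ℤ)ˣ) : M.1 0 0 ≠ 0 ∨ M.1 1 0 ≠ 0 := by
  by_contra! h
  have := (Matrix.isUnit_iff_isUnit_det _).1 M.isUnit
  rw [Matrix.det_fin_two, h.1, h.2] at this
  simp at this

open scoped Pointwise in
/-- Ping-pong: `GL(2, ℤ)` acts on itself by left multiplication and hence on the slope `x / y` of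
the first column `(x, y)`. The matrix `sanovA` adds `2` to the slope, `sanovB` adds `2` to its
inverse, and the sets used are the slope intervals `[1, ∞]`, `(-∞, -1)` for `sanovA` and `[0, 1)`,
`[-1, 0)` for `sanovB`. -/
theorem sanovHom_injective : Function.Injective sanovHom := by
  let X : Fin 2 → Set (Matrix (Fin 2) (Fin 2) ℤ)ˣ :=
    ![{M | M.1 1 0 ^ 2 ≤ M.1 0 0 * M.1 1 0},
      {M | M.1 0 0 = 0 ∨ M.1 0 0 ^ 2 < M.1 0 0 * M.1 1 0}]
  let Y : Fin 2 → Set (Matrix (Fin 2) (Fin 2) ℤ)ˣ :=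
    ![{M | M.1 0 0 * M.1 1 0 < - M.1 1 0 ^ 2},
      {M | M.1 0 0 ≠ 0 ∧ M.1 0 0 * M.1 1 0 ≤ - M.1 0 0 ^ 2}]
  have h01 : Disjoint (X 0) (X 1) := Set.disjoint_left.2 fun M h h' => by
    have := col_ne_zero M
    simp only [X, Matrix.cons_val_zero, Matrix.cons_val_one, Set.mem_ofPred_eq] at h h'
    rcases h' with h' | h'
    · rw [h', zero_mul] at h
      exact this.elim (absurd h') fun h1 => absurd h (not_le.2 (by positivity))
    · nlinarith [sq_nonneg (M.1 0 0 - M.1 1 0)]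
  have h01' : Disjoint (Y 0) (Y 1) := Set.disjoint_left.2 fun M h h' => by
    simp only [Y, Matrix.cons_val_zero, Matrix.cons_val_one, Set.mem_ofPred_eq] at h h'
    nlinarith [sq_nonneg (M.1 0 0 + M.1 1 0)]
  refine FreeGroup.injective_lift_of_ping_pong ![sanovA, sanovB] X Y ?_ ?_ ?_ ?_ ?_ ?_
  · intro i
    fin_cases i
    · exact ⟨1, by simp [X]⟩
    · exact ⟨⟨!![0, 1; 1, 0], !![0, 1; 1, 0], by decide, by decide⟩, by simp [X]⟩
  · intro i k hik
    fin_cases i <;> fin_cases k <;> first | exact absurd rfl hik | exact h01 | exact h01.symm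
  · intro i k hik
    fin_cases i <;> fin_cases k <;> first | exact absurd rfl hik | exact h01' | exact h01'.symm
  · intro i k
    refine Set.disjoint_left.2 fun M h h' => ?_
    have hM := col_ne_zero M
    have h0 := sq_nonneg (M.1 0 0)
    have h1 := sq_nonneg (M.1 1 0)
    fin_cases i <;> fin_cases k <;> simp [X, Y] at h h'
    · linarith
    · exact h'.1 (by nlinarith)
    · rcases h with h | h
      · rw [h] at h'; linarith
      · linarith
    · rcases h with h | h
      · exact h'.1 h
      · linarith
  · intro i
    rintro _ ⟨M, hM, rfl⟩
    have h1 := sq_nonneg (M.1 1 0)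
    have hM' := Matrix.eta_fin_two M.1
    fin_cases i <;> simp [Y] at hM
    · change (sanovA * M).1 1 0 ^ 2 ≤ (sanovA * M).1 0 0 * (sanovA * M).1 1 0
      simp only [sanovA_mul hM']
      simp
      linarith
    · change (sanovB * M).1 0 0 = 0 ∨
        (sanovB * M).1 0 0 ^ 2 < (sanovB * M).1 0 0 * (sanovB * M).1 1 0
      simp only [sanovB_mul hM']
      simp
      by_cases h : M.1 0 0 = 0
      · exact .inl h
      · exact .inr (by linarith [hM h])
  · intro i
    rintro _ ⟨M, hM, rfl⟩
    have h1 := sq_nonneg (M.1 1 0)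
    have hM' := Matrix.eta_fin_two M.1
    fin_cases i <;> simp [X] at hM
    · change (sanovA⁻¹ * M).1 0 0 * (sanovA⁻¹ * M).1 1 0 < - (sanovA⁻¹ * M).1 1 0 ^ 2
      simp only [sanovA_inv_mul hM']
      simp
      linarith
    · change (sanovB⁻¹ * M).1 0 0 ≠ 0 ∧
        (sanovB⁻¹ * M).1 0 0 * (sanovB⁻¹ * M).1 1 0 ≤ - (sanovB⁻¹ * M).1 0 0 ^ 2
      simp only [sanovB_inv_mul hM']
      simp
      exact ⟨hM.1, by linarith⟩

/-- Sanov's criterion, in the direction needed here. Multiplication by powers of the generators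
reduces the first column as in Euclid's algorithm, and the congruences prevent the reduction from
stopping before the second entry vanishes. -/
theorem mem_range_sanovHom (M : (Matrix (Fin 2) (Fin 2) ℤ)ˣ) {a b c d : ℤ}
    (hM : M.1 = !![a, b; c, d]) (hdet : a * d - b * c = 1) (ha : a % 4 = 1) (hb : b % 2 = 0)
    (hc : c % 2 = 0) : M ∈ sanovHom.range := by
  have hA : sanovA ∈ sanovHom.range := ⟨FreeGroup.of 0, by simp [sanovHom]⟩
  have hB : sanovB ∈ sanovHom.range := ⟨FreeGroup.of 1, by simp [sanovHom]⟩
  induction hn : a.natAbs + c.natAbs using Nat.strong_induction_on generalizing M a b c d with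
  | _ n ih =>
    have hstep {S : (Matrix (Fin 2) (Fin 2) ℤ)ˣ} (hS : S ∈ sanovHom.range) {a' b' c' d' : ℤ}
        (h : (S * M).1 = !![a', b'; c', d']) (hdet' : a' * d' - b' * c' = 1) (ha' : a' % 4 = 1)
        (hb' : b' % 2 = 0) (hc' : c' % 2 = 0) (hlt : a'.natAbs + c'.natAbs < n) :
        M ∈ sanovHom.range :=
      (Subgroup.mul_mem_cancel_left _ hS).1 (ih _ hlt _ h hdet' ha' hb' hc' rfl)
    by_cases h0 : c = 0
    · subst h0
      obtain rfl : a = 1 := by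
        rw [mul_zero, sub_zero] at hdet
        rcases Int.eq_one_or_neg_one_of_mul_eq_one hdet with h | h <;> omega
      obtain rfl : d = 1 := by linarith
      have : M = sanovA ^ (b / 2) := by
        ext1
        rw [hM, sanovA_zpow]
        congr!
        omega
      exact this ▸ zpow_mem hA _
    · rcases lt_or_ge c.natAbs a.natAbs with hlt | hge
      · by_cases hs : (a - 2 * c).natAbs < a.natAbs
        · exact hstep (inv_mem hA) (sanovA_inv_mul hM) (by linarith) (by omega) (by omega) hc
            (by omega)
        · exact hstep hA (sanovA_mul hM) (by linarith) (by omega) (by omega) hc (by omega)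
      · by_cases hs : (c - 2 * a).natAbs < c.natAbs
        · exact hstep (inv_mem hB) (sanovB_inv_mul hM) (by linarith) ha hb (by omega) (by omega)
        · exact hstep hB (sanovB_mul hM) (by linarith) ha hb (by omega) (by omega)

/-- Sanov's subgroup has finite index, because it contains the kernel of reduction modulo `4`. -/
theorem finiteIndex_range_sanovHom : sanovHom.range.FiniteIndex := by
  let π : (Matrix (Fin 2) (Fin 2) ℤ)ˣ →* (Matrix (Fin 2) (Fin 2) (ZMod 4))ˣ :=
    Units.map ((Int.castRingHom (ZMod 4)).mapMatrix :
      Matrix (Fin 2) (Fin 2) ℤ →+* Matrix (Fin 2) (Fin 2) (ZMod 4))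
  refine Subgroup.finiteIndex_of_le (H := π.ker) fun M hM => ?_
  have hπ : (π M).1 = 1 := by rw [MonoidHom.mem_ker.1 hM, Units.val_one]
  have h (i j : Fin 2) : ((M.1 i j : ℤ) : ZMod 4) = (1 : Matrix (Fin 2) (Fin 2) (ZMod 4)) i j :=
    congrFun (congrFun hπ i) j
  have h' (i j : Fin 2) (k : ℤ) (hk : (1 : Matrix (Fin 2) (Fin 2) (ZMod 4)) i j = (k : ZMod 4)) :
      M.1 i j % 4 = k % 4 := (ZMod.intCast_eq_intCast_iff' _ _ 4).1 ((h i j).trans hk)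
  have h00 := h' 0 0 1 (by simp)
  have h01 := h' 0 1 0 (by simp)
  have h10 := h' 1 0 0 (by simp)
  have h11 := h' 1 1 1 (by simp)
  refine mem_range_sanovHom M (Matrix.eta_fin_two M.1) ?_ h00 (by omega) (by omega)
  have hunit := (Matrix.isUnit_iff_isUnit_det _).1 M.isUnit
  rw [Matrix.det_fin_two] at hunit
  -- a determinant that is `1` modulo `4` cannot be `-1`
  have hmod : (M.1 0 0 * M.1 1 1 - M.1 0 1 * M.1 1 0) % 4 = 1 := by
    simp [Int.sub_emod, Int.mul_emod, h00, h01, h10, h11]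
  rcases Int.isUnit_iff.1 hunit with h | h <;> omega

/-- `GL(2, ℤ)` is the disjoint union of finitely many cosets of a free group of rank two. -/
theorem exists_transversal : ∃ (m : ℕ) (T : Fin m → (Matrix (Fin 2) (Fin 2) ℤ)ˣ),
    (∀ g, ∃ f t, g = sanovHom f * T t) ∧
    ∀ f t f' t', sanovHom f * T t = sanovHom f' * T t' → f = f' ∧ t = t' := by
  have := finiteIndex_range_sanovHom
  obtain ⟨m, ⟨e⟩⟩ := Finite.exists_equiv_fin ((Matrix (Fin 2) (Fin 2) ℤ)ˣ ⧸ sanovHom.range)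
  -- left cosets are turned into right cosets by inversion
  have key (g h : (Matrix (Fin 2) (Fin 2) ℤ)ˣ)
      (hgh : (g : (Matrix (Fin 2) (Fin 2) ℤ)ˣ ⧸ sanovHom.range) = h) :
      ∃ f, sanovHom f = g⁻¹ * h := QuotientGroup.eq.1 hgh
  refine ⟨m, fun t => (e.symm t).out⁻¹, fun g => ?_, fun f t f' t' h => ?_⟩
  · obtain ⟨f, hf⟩ := key g⁻¹ (e.symm (e (g⁻¹ : (Matrix (Fin 2) (Fin 2) ℤ)ˣ))).out (by simp)
    exact ⟨f, e (g⁻¹ : (Matrix (Fin 2) (Fin 2) ℤ)ˣ), by rw [hf]; simp⟩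
  · have ht : t = t' := by
      apply e.symm.injective
      rw [← (e.symm t).out_eq', ← (e.symm t').out_eq']
      refine QuotientGroup.eq.2 ⟨f⁻¹ * f', ?_⟩
      rw [map_mul, map_inv, inv_mul_eq_iff_eq_mul, ← mul_assoc, ← mul_inv_eq_iff_eq_mul]
      exact h.symm
    subst ht
    exact ⟨sanovHom_injective (mul_right_cancel h), rfl⟩

end GLTwoInt

/-! ### Subgroups of the semigroup of integer matrices -/

section SubgroupsOfSemigroups

variable {S : Type*} [Semigroup S]

/-- The subgroup of a semigroup that consists of a single idempotent. -/
def IsIdempotentElem.subsemigroup {e : S} (he : IsIdempotentElem e) : Subsemigroup S where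
  carrier := {e}
  mul_mem' ha hb := (congrArg₂ (· * ·) ha hb).trans he

theorem IsIdempotentElem.isSubgroupOfSemigroup {e : S} (he : IsIdempotentElem e) :
    IsSubgroupOfSemigroup he.subsemigroup :=
  ⟨e, rfl, fun x hx => by rw [show x = e from hx]; exact ⟨he, he, e, rfl, he, he⟩⟩

end SubgroupsOfSemigroups

/-- The empty list generates no subgroup, as `{0}` and `{1}` are disjoint subgroups. -/
theorem IsSubgroupGeneratedBy.ne_nil {L : List (Matrix (Fin 2) (Fin 2) ℤ)}
    {H : Subsemigroup (Matrix (Fin 2) (Fin 2) ℤ)} (hH : IsSubgroupGeneratedBy L H) : L ≠ [] := by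
  rintro rfl
  obtain ⟨e, he, -⟩ := hH.1.1
  have h (f : Matrix (Fin 2) (Fin 2) ℤ) (hf : IsIdempotentElem f) : e = f :=
    hH.2 (show hf.subsemigroup ∈ _ from ⟨hf.isSubgroupOfSemigroup, by simp⟩) he
  exact zero_ne_one ((h 0 (by simp [IsIdempotentElem])).symm.trans
    (h 1 (by simp [IsIdempotentElem])))

/-- The Cayley-Hamilton theorem for singular matrices of size two. -/
theorem Matrix.mul_self_eq_trace_smul {A : Matrix (Fin 2) (Fin 2) ℤ} (hA : A.det = 0) :
    A * A = A.trace • A := by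
  rw [Matrix.det_fin_two] at hA
  ext i j
  fin_cases i <;> fin_cases j <;>
    simp [Matrix.mul_apply, Matrix.trace_fin_two, Fin.sum_univ_two] <;> linarith

/-- A subgroup of singular matrices with identity `e` is contained in `{e, -e}`: by the
Cayley-Hamilton theorem, the traces of `x` and of its inverse are mutually inverse integers, unless
`e = 0`. -/
theorem eq_or_eq_neg_of_det_eq_zero {e x y : Matrix (Fin 2) (Fin 2) ℤ} (hx : x.det = 0)
    (hy : y.det = 0) (hex : x * e = x) (hxy : x * y = e) :
    x = e ∨ x = -e := by
  by_cases h0 : e = 0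
  · left; rw [← hex, h0, mul_zero]
  have hxx := Matrix.mul_self_eq_trace_smul hx
  have hyy := Matrix.mul_self_eq_trace_smul hy
  have hone : x.trace * y.trace = 1 := by
    have h : (x.trace * y.trace) • e = (1 : ℤ) • e := by
      calc (x.trace * y.trace) • e = (x.trace • x) * (y.trace • y) := by
            rw [smul_mul_smul_comm, hxy]
        _ = x * (x * y) * y := by rw [← hxx, ← hyy]; simp only [mul_assoc]
        _ = (1 : ℤ) • e := by rw [hxy, hex, hxy, one_smul]
    by_contra hne
    obtain ⟨i, j, hij⟩ : ∃ i j, e i j ≠ 0 := by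
      by_contra! h'
      exact h0 (Matrix.ext h')
    have := congrFun (congrFun h i) j
    simp only [Matrix.smul_apply, smul_eq_mul] at this
    exact hne (mul_right_cancel₀ hij this)
  have hx' : x = x.trace • e := by
    calc x = x * x * y := by rw [mul_assoc, hxy, hex]
      _ = x.trace • e := by rw [hxx, smul_mul_assoc, hxy]
  rcases Int.eq_one_or_neg_one_of_mul_eq_one hone with h | h
  · left; rw [h, one_smul] at hx'; exact hx'
  · right; rw [h, neg_one_smul] at hx'; exact hx'

/-- A subgroup with a noninvertible generator has at most two elements, and they can be read off
from the generators. -/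
theorem IsSubgroupGeneratedBy.mem_iff_of_not_isUnit {L : List (Matrix (Fin 2) (Fin 2) ℤ)}
    {H : Subsemigroup (Matrix (Fin 2) (Fin 2) ℤ)} (hH : IsSubgroupGeneratedBy L H)
    (hL : ∃ h ∈ L, ¬ IsUnit h) (Y : Matrix (Fin 2) (Fin 2) ℤ) :
    Y ∈ H ↔ Y ∈ L ∨ ∃ h ∈ L, Y = h * h := by
  refine ⟨fun hY => ?_, ?_⟩
  · obtain ⟨e, heH, he⟩ := hH.1.1
    obtain ⟨h, hhL, hh⟩ := hL
    have hee : e * e = e := (he e heH).1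
    have hdet : e.det = 0 := by
      have h1 : e.det * e.det = e.det := by rw [← Matrix.det_mul, hee]
      by_contra h0
      have he1 : e = 1 := by
        have : IsUnit e := (Matrix.isUnit_iff_isUnit_det e).2 <| by
          rw [mul_right_cancel₀ h0 (h1.trans (one_mul _).symm)]; exact isUnit_one
        exact this.mul_left_cancel (by rw [hee, mul_one])
      obtain ⟨-, -, y, -, hy, hy'⟩ := he h (hH.1.2 h hhL)
      exact hh ⟨⟨h, y, hy.trans he1, hy'.trans he1⟩, rfl⟩
    have hdet' (x) (hx : x ∈ H) : x.det = 0 := by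
      rw [← (he x hx).1, Matrix.det_mul, hdet, zero_mul]
    have hpm (x) (hx : x ∈ H) : x = e ∨ x = -e := by
      obtain ⟨-, hxe, y, hy, hxy, -⟩ := he x hx
      exact eq_or_eq_neg_of_det_eq_zero (hdet' x hx) (hdet' y hy) hxe hxy
    have hsq (x) (hx : x ∈ H) : x * x = e := by
      rcases hpm x hx with rfl | rfl <;> simp [hee]
    by_cases hall : ∀ x ∈ L, x = e
    · have hle : H ≤ IsIdempotentElem.subsemigroup hee :=
        hH.2 ⟨IsIdempotentElem.isSubgroupOfSemigroup hee, hall⟩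
      exact .inl (by rw [show Y = e from hle hY, ← hall h hhL]; exact hhL)
    · push Not at hall
      obtain ⟨x, hx, hxe⟩ := hall
      rcases hpm Y hY with h' | h'
      · exact .inr ⟨x, hx, by rw [hsq x (hH.1.2 x hx), h']⟩
      · exact .inl (by rw [h', ← (hpm x (hH.1.2 x hx)).resolve_left hxe]; exact hx)
  · rintro (h | ⟨h, hh, rfl⟩)
    · exact hH.1.2 Y h
    · exact mul_mem (hH.1.2 h hh) (hH.1.2 h hh)

/-- A subgroup generated by invertible matrices is the subgroup that they generate in the group of
units. -/
theorem IsSubgroupGeneratedBy.mem_iff_of_isUnit {L : List (Matrix (Fin 2) (Fin 2) ℤ)}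
    {H : Subsemigroup (Matrix (Fin 2) (Fin 2) ℤ)} (hH : IsSubgroupGeneratedBy L H)
    (hL : ∀ h ∈ L, IsUnit h) (Y : Matrix (Fin 2) (Fin 2) ℤ) :
    Y ∈ H ↔ ∃ u ∈ Subgroup.closure {u : (Matrix (Fin 2) (Fin 2) ℤ)ˣ | u.1 ∈ L}, u.1 = Y := by
  constructor
  · intro hY
    let K := (Subgroup.closure {u : (Matrix (Fin 2) (Fin 2) ℤ)ˣ | u.1 ∈ L}).toSubmonoid.map
      (Units.coeHom _)
    have hle : H ≤ K.toSubsemigroup := by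
      refine hH.2 ⟨⟨1, one_mem K, ?_⟩, fun h hh => ?_⟩
      · rintro _ ⟨u, hu, rfl⟩
        exact ⟨one_mul _, mul_one _, _, ⟨u⁻¹, Subgroup.inv_mem _ hu, rfl⟩, u.mul_inv, u.inv_mul⟩
      · obtain ⟨u, rfl⟩ := hL h hh
        exact ⟨u, Subgroup.subset_closure hh, rfl⟩
    exact hle hY
  · rintro ⟨u, hu, rfl⟩
    obtain ⟨e, heH, he⟩ := hH.1.1
    obtain ⟨h, hh⟩ := List.exists_mem_of_ne_nil L hH.ne_nil
    obtain rfl : e = 1 :=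
      (hL h hh).mul_right_cancel (by rw [(he h (hH.1.2 h hh)).1, one_mul])
    induction hu using Subgroup.closure_induction with
    | mem u hu => exact hH.1.2 _ hu
    | one => exact heH
    | mul u v _ _ hu hv => exact mul_mem hu hv
    | inv u _ hu =>
      obtain ⟨-, -, y, hy, hy', -⟩ := he _ hu
      rwa [Units.inv_eq_of_mul_eq_one_right hy']

/-! ### Primitive recursive operations on words -/

/-- The image of `k` under the word `w`, if the generators act as products of transpositions.
Irreducible, as unification would otherwise try to evaluate it. -/
@[irreducible] def wordAct (p : Fin 2 → List (ℕ × ℕ)) (w : List (Fin 2 × Bool)) (k : ℕ) : ℕ :=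
  FreeGroup.lift (fun i => swapProd (p i)) (FreeGroup.mk w) k

namespace Primrec

theorem swap_apply : Primrec₂ fun (p : ℕ × ℕ) (k : ℕ) => Equiv.swap p.1 p.2 k :=
  (Primrec.ite (Primrec.eq.comp snd (fst.comp fst)) (snd.comp fst)
    (Primrec.ite (Primrec.eq.comp snd (snd.comp fst)) (fst.comp fst) snd) :
    Primrec fun x : (ℕ × ℕ) × ℕ =>
      if x.2 = x.1.1 then x.1.2 else if x.2 = x.1.2 then x.1.1 else x.2).of_eq fun _ =>
    (Equiv.swap_apply_def _ _ _).symm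

theorem swapProd_apply : Primrec₂ fun (l : List (ℕ × ℕ)) (k : ℕ) => swapProd l k :=
  (list_foldr fst snd (swap_apply.comp (fst.comp snd) (snd.comp snd)).to₂).of_eq fun ⟨l, k⟩ => by
    induction l with
    | nil => simp [swapProd]
    | cons p l ih => simp_all [swapProd]

theorem _root_.swapProd_reverse (l : List (ℕ × ℕ)) : swapProd l.reverse = (swapProd l)⁻¹ := by
  simp [swapProd, List.prod_inv_reverse, Function.comp_def]

/-- The action on `ℕ` of the words in the generators of a free group is primitive recursive, also
in the lists of transpositions that define the action. -/
theorem wordAct : Primrec fun x : ((Fin 2 → List (ℕ × ℕ)) × List (Fin 2 × Bool)) × ℕ =>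
    _root_.wordAct x.1.1 x.1.2 x.2 := by
  have hl : Primrec₂ fun (p : Fin 2 → List (ℕ × ℕ)) (a : Fin 2 × Bool) =>
      bif a.2 then p a.1 else (p a.1).reverse :=
    have h : Primrec fun x : (Fin 2 → List (ℕ × ℕ)) × Fin 2 × Bool => x.1 x.2.1 :=
      fin_app.comp fst (fst.comp snd)
    Primrec.cond (snd.comp snd) h (list_reverse.comp h)
  refine (list_foldr (snd.comp fst) snd (swapProd_apply.comp
    (hl.comp (fst.comp (fst.comp fst)) (fst.comp snd)) (snd.comp snd)).to₂).of_eq ?_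
  rintro ⟨⟨p, w⟩, k⟩
  induction w with
  | nil => simp [_root_.wordAct]
  | cons a w ih =>
    obtain ⟨i, _ | _⟩ := a <;> simp_all [_root_.wordAct, swapProd_reverse]

theorem sanovHom_mk : Primrec fun w : List (Fin 2 × Bool) =>
    (GLTwoInt.sanovHom (FreeGroup.mk w)).1 := by
  refine (matrix_list_prod.comp (list_map Primrec.id ((dom_finite fun a : Fin 2 × Bool =>
    (GLTwoInt.sanovHom (FreeGroup.mk [a])).1).comp snd).to₂)).of_eq fun w => ?_
  induction w with
  | nil => simp [← FreeGroup.one_eq_mk]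
  | cons a w ih =>
    simp only [id, List.map_cons, List.prod_cons] at ih ⊢
    rw [ih, ← Units.val_mul, ← map_mul, FreeGroup.mul_mk, List.singleton_append]

theorem _root_.PrimrecPred.isUnit_matrix :
    PrimrecPred fun A : Matrix (Fin 2) (Fin 2) ℤ => IsUnit A := by
  -- the determinant is `1` or `-1`; both equations are written without subtraction
  have h (i j k l : Fin 2) : Primrec fun A : Matrix (Fin 2) (Fin 2) ℤ => A i j * A k l :=
    int_mul.comp (matrix_apply i j) (matrix_apply k l)
  have h' (i j k l i' j' k' l' : Fin 2) : PrimrecPred fun A : Matrix (Fin 2) (Fin 2) ℤ =>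
      A i j * A k l = A i' j' * A k' l' + 1 :=
    Primrec.eq.comp (h i j k l) (int_add.comp (h i' j' k' l') (const 1))
  refine ((h' 0 0 1 1 0 1 1 0).or (h' 0 1 1 0 0 0 1 1)).of_eq fun A => ?_
  rw [Matrix.isUnit_iff_isUnit_det, Int.isUnit_iff, Matrix.det_fin_two]
  omega

end Primrec

/-! ### The membership problem for `GL(2, ℤ)` -/

namespace GLTwoInt

variable {m : ℕ} (T : Fin m → (Matrix (Fin 2) (Fin 2) ℤ)ˣ)

/-- The data of a certificate that a matrix is not in a subgroup of `GL(2, ℤ)`: permutations of `ℕ`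
for the generators of the free group (as products of transpositions), a point of `ℕ` for each coset
representative, and a list of decompositions `φ f * T t` (as words and indices). -/
abbrev SeparationData (m : ℕ) : Type :=
  ((Fin 2 → List (ℕ × ℕ)) × (Fin m → ℕ)) × List (List (Fin 2 × Bool) × Fin m)

/-- The matrix `T t * h` has a decomposition `φ f * T t'` listed in `c` for which `f • s t'` and
`s t` are equal (if `b` is true), or different (if `b` is false). -/
def MovesTo (b : Bool) (c : SeparationData m) (t : Fin m) (h : Matrix (Fin 2) (Fin 2) ℤ) : Prop :=
  ∃ d ∈ c.2, (T t).1 * h = (sanovHom (FreeGroup.mk d.1)).1 * (T d.2).1 ∧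
    (wordAct c.1.1 d.1 (c.1.2 d.2) == c.1.2 t) = b

/-- The certificate `c` shows that `Y` is not in the subgroup generated by `L`. -/
def Separates (c : SeparationData m) (L : List (Matrix (Fin 2) (Fin 2) ℤ))
    (Y : Matrix (Fin 2) (Fin 2) ℤ) : Prop :=
  (∀ h ∈ L, ∀ t ∈ List.finRange m, MovesTo T true c t h) ∧
    ∃ t ∈ List.finRange m, MovesTo T false c t Y

theorem primrecRel_movesTo (b : Bool) :
    PrimrecRel fun (t : Fin m) (x : SeparationData m × Matrix (Fin 2) (Fin 2) ℤ) =>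
      MovesTo T b x.1 t x.2 := by
  have hT : Primrec fun t => (T t).1 := Primrec.dom_finite _
  open Primrec in
  have hs : Primrec fun x : (List (Fin 2 × Bool) × Fin m) × Fin m × SeparationData m ×
      Matrix (Fin 2) (Fin 2) ℤ => x.2.2.1.1.2 :=
    snd.comp (fst.comp (fst.comp (snd.comp snd)))
  have h₁ : PrimrecRel fun (d : List (Fin 2 × Bool) × Fin m)
      (x : Fin m × SeparationData m × Matrix (Fin 2) (Fin 2) ℤ) =>
      (T x.1).1 * x.2.2 = (sanovHom (FreeGroup.mk d.1)).1 * (T d.2).1 :=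
    Primrec.eq.comp (matrix_mul.comp (hT.comp (fst.comp snd)) (snd.comp (snd.comp snd)))
      (matrix_mul.comp (sanovHom_mk.comp (fst.comp fst)) (hT.comp (snd.comp fst)))
  have h₂ : PrimrecRel fun (d : List (Fin 2 × Bool) × Fin m)
      (x : Fin m × SeparationData m × Matrix (Fin 2) (Fin 2) ℤ) =>
      (wordAct x.2.1.1.1 d.1 (x.2.1.1.2 d.2) == x.2.1.1.2 x.1) = b :=
    Primrec.eq.comp (Primrec.beq.comp (Primrec.wordAct.comp
        (pair (pair (fst.comp (fst.comp (fst.comp (snd.comp snd)))) (fst.comp fst))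
          (fin_app.comp hs (snd.comp fst))))
      (fin_app.comp hs (fst.comp snd))) (const b)
  exact (PrimrecPred.and h₁ h₂).primrecRel.exists_mem_list.comp
    (Primrec.snd.comp (Primrec.fst.comp Primrec.snd)) Primrec.id

theorem primrecPred_separates : PrimrecPred fun x : SeparationData m ×
    List (Matrix (Fin 2) (Fin 2) ℤ) × Matrix (Fin 2) (Fin 2) ℤ => Separates T x.1 x.2.1 x.2.2 := by
  open Primrec in
  have h₁ : PrimrecRel fun (h : Matrix (Fin 2) (Fin 2) ℤ) (c : SeparationData m) =>
      ∀ t ∈ List.finRange m, MovesTo T true c t h :=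
    (primrecRel_movesTo T true).forall_mem_list.comp (const _) (pair snd fst)
  have h₂ : PrimrecRel fun (h : Matrix (Fin 2) (Fin 2) ℤ) (c : SeparationData m) =>
      ∃ t ∈ List.finRange m, MovesTo T false c t h :=
    (primrecRel_movesTo T false).exists_mem_list.comp (const _) (pair snd fst)
  exact (h₁.forall_mem_list.comp (fst.comp snd) fst).and (h₂.comp (snd.comp snd) fst)

/-- `W` is a list of generators and inverses of generators with product `Y`. -/
def Factors (L W : List (Matrix (Fin 2) (Fin 2) ℤ)) (Y : Matrix (Fin 2) (Fin 2) ℤ) : Prop :=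
  (∀ w ∈ W, w ∈ L ∨ ∃ h ∈ L, h * w = 1) ∧ W.prod = Y

theorem primrecRel_mem {α : Type*} [Primcodable α] :
    PrimrecRel fun (a : α) (l : List α) => a ∈ l :=
  PrimrecPred.of_eq ((Primrec.eq (α := α)).exists_mem_list.comp Primrec.snd Primrec.fst) (by simp)

theorem primrecPred_factors : PrimrecPred fun x : List (Matrix (Fin 2) (Fin 2) ℤ) ×
    List (Matrix (Fin 2) (Fin 2) ℤ) × Matrix (Fin 2) (Fin 2) ℤ => Factors x.2.1 x.1 x.2.2 := by
  open Primrec in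
  have h₁ : PrimrecRel fun h w : Matrix (Fin 2) (Fin 2) ℤ => h * w = 1 :=
    Primrec.eq.comp matrix_mul (const 1)
  have h₂ : PrimrecRel fun (w : Matrix (Fin 2) (Fin 2) ℤ) (L : List (Matrix (Fin 2) (Fin 2) ℤ)) =>
      w ∈ L ∨ ∃ h ∈ L, h * w = 1 :=
    primrecRel_mem.or (h₁.exists_mem_list.comp snd fst)
  exact (h₂.forall_mem_list.comp fst (fst.comp snd)).and
    (Primrec.eq.comp (matrix_list_prod.comp fst) (snd.comp snd))

/-- A group element is a product of generators and their inverses exactly if it belongs to the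
subgroup. -/
theorem exists_factors_iff {L : List (Matrix (Fin 2) (Fin 2) ℤ)} (hL : ∀ h ∈ L, IsUnit h)
    {Y : Matrix (Fin 2) (Fin 2) ℤ} : (∃ W, Factors L W Y) ↔
      ∃ u ∈ Subgroup.closure {u : (Matrix (Fin 2) (Fin 2) ℤ)ˣ | u.1 ∈ L}, u.1 = Y := by
  constructor
  · rintro ⟨W, hW, rfl⟩
    induction W with
    | nil => exact ⟨1, one_mem _, rfl⟩
    | cons w W ih =>
      obtain ⟨v, hv, hv'⟩ := ih fun x hx => hW x (List.mem_cons_of_mem w hx)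
      rcases hW w List.mem_cons_self with hw | ⟨h, hh, hw⟩
      · obtain ⟨u, rfl⟩ := hL w hw
        exact ⟨u * v, mul_mem (Subgroup.subset_closure hw) hv, by simp [hv']⟩
      · obtain ⟨u, rfl⟩ := hL h hh
        refine ⟨u⁻¹ * v, mul_mem (inv_mem (Subgroup.subset_closure hh)) hv, ?_⟩
        rw [Units.val_mul, hv', List.prod_cons, Units.inv_eq_of_mul_eq_one_right hw]
  · rintro ⟨u, hu, rfl⟩
    rw [← Subgroup.mem_toSubmonoid, Subgroup.closure_toSubmonoid] at hu
    obtain ⟨W, hW, rfl⟩ := Submonoid.exists_list_of_mem_closure hu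
    refine ⟨W.map Units.val, fun w hw => ?_, (map_list_prod (Units.coeHom _) W).symm⟩
    obtain ⟨v, hv, rfl⟩ := List.mem_map.1 hw
    exact (hW v hv).imp id fun h => ⟨_, h, v.inv_mul⟩

/-- Certificates of nonmembership are sound and complete. -/
theorem exists_separates_iff (hT : ∀ g, ∃ f t, g = sanovHom f * T t)
    (hT' : ∀ f t f' t', sanovHom f * T t = sanovHom f' * T t' → f = f' ∧ t = t')
    {L : List (Matrix (Fin 2) (Fin 2) ℤ)} (hL : ∀ h ∈ L, IsUnit h)
    (Y : (Matrix (Fin 2) (Fin 2) ℤ)ˣ) : (∃ c, Separates T c L Y) ↔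
      Y ∉ Subgroup.closure {u : (Matrix (Fin 2) (Fin 2) ℤ)ˣ | u.1 ∈ L} := by
  constructor
  · rintro ⟨⟨⟨p, s⟩, D⟩, h, t, -, d, -, hd, hd'⟩
    refine notMem_closure_of_equivariant hT hT' (FreeGroup.lift fun i => swapProd (p i)) s
      (fun u hu t => ?_) ⟨t, FreeGroup.mk d.1, d.2, Units.ext hd,
        by rw [wordAct] at hd'; exact ne_of_beq_false hd'⟩
    obtain ⟨d, -, hd, hd'⟩ := h u hu t (List.mem_finRange t)
    exact ⟨FreeGroup.mk d.1, d.2, Units.ext hd, by rw [wordAct] at hd'; exact eq_of_beq hd'⟩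
  · intro hY
    have hfin : {u : (Matrix (Fin 2) (Fin 2) ℤ)ˣ | u.1 ∈ L}.Finite :=
      L.finite_toSet.preimage Units.val_injective.injOn
    have : Countable (Matrix (Fin 2) (Fin 2) ℤ) := inferInstanceAs (Countable (Fin 2 → Fin 2 → ℤ))
    have : Countable (Matrix (Fin 2) (Fin 2) ℤ)ˣ := Units.val_injective.countable
    obtain ⟨p, s, hps, t₀, f₀, t₀', h₀, h₀'⟩ := exists_swapProd_of_notMem_closure hT hfin hY
    have : Nonempty (Fin m) := ⟨t₀⟩
    choose! f t' hf hf' using hps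
    -- the decomposition that moves `Y`, followed by those for the generators
    refine ⟨((p, s), (f₀.toWord, t₀') :: (hfin.toFinset ×ˢ Finset.univ).toList.map
      fun x => ((f x.1 x.2).toWord, t' x.1 x.2)), fun h hh t _ => ?_, t₀, List.mem_finRange _,
      _, List.mem_cons_self, ?_, ?_⟩
    · obtain ⟨u, rfl⟩ := hL h hh
      refine ⟨_, List.mem_cons_of_mem _ (List.mem_map_of_mem (a := (u, t)) (by simpa using hh)),
        ?_, ?_⟩
      · rw [FreeGroup.mk_toWord, ← Units.val_mul, ← Units.val_mul, hf u hh t]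
      · exact beq_iff_eq.2 (by rw [wordAct, FreeGroup.mk_toWord]; exact hf' u hh t)
    · rw [FreeGroup.mk_toWord, ← Units.val_mul, ← Units.val_mul, h₀]
    · exact beq_eq_false_iff_ne.2 (by rw [wordAct, FreeGroup.mk_toWord]; exact h₀')

/-- The subgroup membership problem for `GL(2, ℤ)` is decidable. -/
theorem exists_computable_mem_closure :
    ∃ f : List (Matrix (Fin 2) (Fin 2) ℤ) × Matrix (Fin 2) (Fin 2) ℤ → Bool, Computable f ∧
      ∀ L Y, (∀ h ∈ L, IsUnit h) → (f (L, Y) = true ↔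
        ∃ u ∈ Subgroup.closure {u : (Matrix (Fin 2) (Fin 2) ℤ)ˣ | u.1 ∈ L}, u.1 = Y) := by
  obtain ⟨m, T, hT, hT'⟩ := exists_transversal
  -- the first alternative makes `R` total on inputs that are not lists of invertible matrices
  let R : List (Matrix (Fin 2) (Fin 2) ℤ) × Matrix (Fin 2) (Fin 2) ℤ →
      Bool × List (Matrix (Fin 2) (Fin 2) ℤ) × SeparationData m → Prop := fun x c =>
    (∃ h ∈ x.1, ¬ IsUnit h) ∨ (c.1 = true ∧ Factors x.1 c.2.1 x.2) ∨
      (c.1 = false ∧ (¬ IsUnit x.2 ∨ Separates T c.2.2 x.1 x.2))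
  have hR : PrimrecRel R := by
    open Primrec in
    refine PrimrecPred.or ?_ (PrimrecPred.or (PrimrecPred.and ?_ ?_)
      (PrimrecPred.and ?_ (PrimrecPred.or ?_ ?_)))
    · exact PrimrecPred.isUnit_matrix.not.exists_mem_list.comp (fst.comp fst)
    · exact Primrec.eq.comp (fst.comp snd) (const _)
    · exact primrecPred_factors.comp (pair (fst.comp (snd.comp snd)) fst)
    · exact Primrec.eq.comp (fst.comp snd) (const _)
    · exact PrimrecPred.isUnit_matrix.not.comp (snd.comp fst)
    · exact (primrecPred_separates T).comp (pair (snd.comp (snd.comp snd)) fst)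
  obtain ⟨f, hf, hf'⟩ := hR.exists_computable_choice fun x => by
    by_cases hL : ∀ h ∈ x.1, IsUnit h
    · by_cases hW : ∃ W, Factors x.1 W x.2
      · obtain ⟨W, hW⟩ := hW
        exact ⟨⟨true, W, default⟩, .inr (.inl ⟨rfl, hW⟩)⟩
      · by_cases hY : IsUnit x.2
        · obtain ⟨Y, hY⟩ := hY
          rw [exists_factors_iff hL] at hW
          obtain ⟨c, hc⟩ := (exists_separates_iff T hT hT' hL Y).2 fun h => hW ⟨Y, h, hY⟩
          exact ⟨⟨false, [], c⟩, .inr (.inr ⟨rfl, .inr (hY ▸ hc)⟩)⟩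
        · exact ⟨⟨false, [], default⟩, .inr (.inr ⟨rfl, .inl hY⟩)⟩
    · push Not at hL
      exact ⟨default, .inl hL⟩
  refine ⟨fun x => (f x).1, Computable.fst.comp hf, fun L Y hL => ?_⟩
  rcases hf' (L, Y) with ⟨h, hh, hh'⟩ | ⟨h, h'⟩ | ⟨h, h'⟩
  · exact absurd (hL h hh) hh'
  · simpa only [h, true_iff] using (exists_factors_iff hL).1 ⟨_, h'⟩
  · simp only [h, Bool.false_eq_true, false_iff]
    rintro ⟨u, hu, rfl⟩
    rcases h' with h' | h'
    · exact h' u.isUnit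
    · exact (exists_separates_iff T hT hT' hL u).1 ⟨_, h'⟩ hu

end GLTwoInt

/-! ### The membership problem for the semigroup of integer matrices -/

theorem mainTheorem1 :
    ∃ decideMem : List (Matrix (Fin 2) (Fin 2) ℤ) × Matrix (Fin 2) (Fin 2) ℤ → Bool,
      Computable decideMem ∧
      ∀ (L : List (Matrix (Fin 2) (Fin 2) ℤ)) (H : Subsemigroup (Matrix (Fin 2) (Fin 2) ℤ)),
        IsSubgroupGeneratedBy L H →
        ∀ Y : Matrix (Fin 2) (Fin 2) ℤ, decideMem (L, Y) = true ↔ Y ∈ H := by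
  classical
  obtain ⟨f, hf, hf'⟩ := GLTwoInt.exists_computable_mem_closure
  have hsing : PrimrecPred fun x : List (Matrix (Fin 2) (Fin 2) ℤ) × Matrix (Fin 2) (Fin 2) ℤ =>
      ∃ h ∈ x.1, ¬ IsUnit h :=
    PrimrecPred.isUnit_matrix.not.exists_mem_list.comp Primrec.fst
  have hmem : PrimrecPred fun x : List (Matrix (Fin 2) (Fin 2) ℤ) × Matrix (Fin 2) (Fin 2) ℤ =>
      x.2 ∈ x.1 ∨ ∃ h ∈ x.1, x.2 = h * h := by
    have h : PrimrecRel fun h Y : Matrix (Fin 2) (Fin 2) ℤ => Y = h * h :=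
      Primrec.eq.comp Primrec.snd (Primrec.matrix_mul.comp Primrec.fst Primrec.fst)
    exact (GLTwoInt.primrecRel_mem.comp Primrec.snd Primrec.fst).or
      (h.exists_mem_list.comp Primrec.fst Primrec.snd)
  refine ⟨fun x => cond (decide (∃ h ∈ x.1, ¬ IsUnit h))
    (decide (x.2 ∈ x.1 ∨ ∃ h ∈ x.1, x.2 = h * h)) (f x),
    Computable.cond hsing.decide.to_comp hmem.decide.to_comp hf, fun L H hH Y => ?_⟩
  by_cases hL : ∃ h ∈ L, ¬ IsUnit h
  · simp only [hL, decide_true, cond_true, decide_eq_true_eq]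
    exact (hH.mem_iff_of_not_isUnit hL Y).symm
  · have hL' : ∀ h ∈ L, IsUnit h := by push Not at hL; exact hL
    simp only [hL, decide_false, cond_false]
    exact (hf' L Y hL').trans (hH.mem_iff_of_isUnit hL' Y).symm
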